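/- Let $a\ge 1$ be an integer and let $T_a:\mathbb R^3\to\mathbb R^3$, $$T_a(x,y,z)=\bigl(xU_a(y)-zU_{a-1}(y),\;xU_{a-1}(y)-zU_{a-2}(y),\;y\bigr),$$ where $U_n$ are the Chebyshev polynomials of the second kind ($U_{-1}=0$, $U_0=1$, $U_{n+1}(y)=2yU_n(y)-U_{n-1}(y)$). The point $P_1=(1,1,1)$ is fixed by $T_a$. For $\lambda>0$ let $$S_\lambda=\{(x,y,z)\in\mathbb R^3: x^2+y^2+z^2-2xyz-1=\lambda^2/4\}.$$ A center manifold of $T_a$ at $P_1$ of class $C^r$ ($r\ge 1$) is an embedded $C^r$ submanifold $W\subset\mathbb R^3$ through $P_1$ that is locally invariant (there is a neighborhood $N$ of $P_1$ with $T_a(W\cap N)\subset W$) and whose tangent space at $P_1$ is the center subspace of $DT_a(P_1)$, that is, the space of real vectors in the sum of the generalized eigenspaces of $DT_a(P_1)$ over $\mathbb C$ for the eigenvalues of modulus $1$. Then $T_a$ has a center manifold of class $C^\infty$ at $P_1$. Moreover, every center manifold $W$ of class $C^1$ of $T_a$ at $P_1$ is a curve, and there is a neighborhood $V_0$ of $P_1$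 with the following properties. 1. Either every point of $W\cap V_0$ is fixed by $T_a$, or every point of $W\cap V_0$ other than $P_1$ is periodic under $T_a$ with least period $2$. 2. For every neighborhood $V\subset V_0$ of $P_1$ there is $\lambda_0>0$ such that for all $\lambda\in(0,\lambda_0)$: the manifolds $W$ and $S_\lambda$ are transversal at each point of $W\cap S_\lambda\cap V$, this intersection consists of exactly two points, $W\cap S_\lambda\cap V=\{p,q\}$ with $p\ne q$, and it is invariant: $T_a(\{p,q\})=\{p,q\}$. -/

import Mathlib

open Topology Set
open scoped ContDiff

namespace TraceMap

/-- The space `ℝ³`; only its topology and smooth structure are used. -/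
abbrev R3 : Type := Fin 3 → ℝ

/-- The trace map
`T_a (x, y, z) = (x U_a(y) - z U_{a-1}(y), x U_{a-1}(y) - z U_{a-2}(y), y)`,
where `U_n` are the Chebyshev polynomials of the second kind (`U_{-1} = 0`, `U_0 = 1`). -/
noncomputable def T (a : ℕ) (v : R3) : R3 :=
  ![v 0 * (Polynomial.Chebyshev.U ℝ (a : ℤ)).eval (v 1)
      - v 2 * (Polynomial.Chebyshev.U ℝ ((a : ℤ) - 1)).eval (v 1),
    v 0 * (Polynomial.Chebyshev.U ℝ ((a : ℤ) - 1)).eval (v 1)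
      - v 2 * (Polynomial.Chebyshev.U ℝ ((a : ℤ) - 2)).eval (v 1),
    v 1]

/-- The Fricke–Vogt invariant `I(x, y, z) = x² + y² + z² - 2xyz - 1`. -/
def frickeVogt (v : R3) : ℝ :=
  v 0 ^ 2 + v 1 ^ 2 + v 2 ^ 2 - 2 * v 0 * v 1 * v 2 - 1

/-- The level surface `S_λ = {I = λ² / 4}`. -/
def S (lam : ℝ) : Set R3 := {v | frickeVogt v = lam ^ 2 / 4}

/-- The point `P₁ = (1, 1, 1)`. -/
def P₁ : R3 := ![1, 1, 1]

section General

variable {E : Type*} [NormedAddCommGroup E] [NormedSpace ℝ E]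

/-- `W` is an embedded `C^r` submanifold of `E`, without boundary, of dimension `k`: near each of
its points some `C^r` diffeomorphism between open subsets of `E` straightens `W` to a linear
subspace of dimension `k`. -/
def IsEmbeddedSubmanifold (r : WithTop ℕ∞) (k : ℕ) (W : Set E) : Prop :=
  ∀ x ∈ W, ∃ (Φ : OpenPartialHomeomorph E E) (F : Submodule ℝ E),
    x ∈ Φ.source ∧ ContDiffOn ℝ r Φ Φ.source ∧ ContDiffOn ℝ r Φ.symm Φ.target ∧
    Module.finrank ℝ F = k ∧ ∀ y ∈ Φ.source, y ∈ W ↔ Φ y ∈ F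

/-- The tangent space at `x` of a submanifold `M`, spanned by the velocities at time `0` of the
curves in `M` that pass through `x` at time `0`. -/
def tangentSpace (M : Set E) (x : E) : Submodule ℝ E :=
  Submodule.span ℝ
    {v | ∃ γ : ℝ → E, γ 0 = x ∧ (∀ᶠ t in 𝓝 (0 : ℝ), γ t ∈ M) ∧ HasDerivAt γ v 0}

/-- The submanifolds `M` and `N` are transversal at the point `x`. -/
def TransversalAt (M N : Set E) (x : E) : Prop :=
  tangentSpace M x ⊔ tangentSpace N x = ⊤

/-- The center subspace of a real linear map `A`: the real vectors in the sum of the generalized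
eigenspaces of the complexification of `A` for the eigenvalues of modulus one. -/
noncomputable def centerSubspace (A : E →ₗ[ℝ] E) : Submodule ℝ E :=
  ((⨆ μ : {μ : ℂ // ‖μ‖ = 1},
      Module.End.maxGenEigenspace (A.baseChange ℂ) (μ : ℂ)).restrictScalars ℝ).comap
    (TensorProduct.mk ℝ ℂ E 1)

/-- `W` is a (local) center manifold of class `C^r` of the map `f` at its fixed point `p`:
a locally invariant embedded submanifold through `p`, whose tangent space at `p` is the
center subspace of the derivative of `f` at `p`. -/
structure IsCenterManifold (r : WithTop ℕ∞) (f : E → E) (p : E) (W : Set E) : Prop where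
  fixed : f p = p
  mem : p ∈ W
  submanifold :
    IsEmbeddedSubmanifold r (Module.finrank ℝ (centerSubspace (fderiv ℝ f p : E →ₗ[ℝ] E))) W
  tangent : tangentSpace W p = centerSubspace (fderiv ℝ f p : E →ₗ[ℝ] E)
  invariant : ∀ᶠ x in 𝓝 p, x ∈ W → f x ∈ W

end General

end TraceMap

namespace TraceMap

open Polynomial Module

/-! Write `I` for `frickeVogt`. The derivative of `T a` at `P₁` has eigenvalue `-1` along `(-a, 1,
-1)`, and its other two eigenvalues are the roots of `X² - (a² + 2) X + 1`, which lie off the unit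
circle because `a² + 2 > 2`. So a center manifold is a curve `γ`, on which `T a` acts by a map `τ`
of the parameter with `τ' (0) = -1`.

`T a` preserves `I` (`frickeVogt_T`), and along `γ` the function `I` has a strict minimum at `P₁`,
monotone on each side (`eventually_mul_deriv_pos`). As `τ` exchanges the sides, `τ (τ t)` lies on
the side of `t` at the same level of `I`, hence `τ (τ t) = t` (`exists_curve_involution`). Every
nearby point of the curve other than `P₁` thus has least period two; the alternative with fixed
points never occurs. A low level of `I` meets each side once, transversally since `I` has nonzero
derivative there, and `τ` exchanges the two points.

For existence no center manifold theorem is needed: the points with `T a (x, y, z) = (2yz - x, z,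
y)` whose image satisfies the same condition are cut out by two equations with independent
differentials at `P₁`, and this set is itself a smooth center manifold. -/

/-! ### Chebyshev identities, the invariant and the derivative at the fixed point -/

/-- The recurrence leaves this quantity unchanged under `n ↦ n + 1`. It is the factor by which `T a`
multiplies the form `x² + z² - 2xyz` at fixed `y`, whence the invariance of `I`. -/
theorem eval_U_sq_sub_mul (n : ℤ) (y : ℝ) :
    (Chebyshev.U ℝ n).eval y ^ 2
      - (Chebyshev.U ℝ (n + 1)).eval y * (Chebyshev.U ℝ (n - 1)).eval y = 1 := by
  induction n using Int.induction_on with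
  | zero => simp
  | succ n ih =>
    have h1 := congrArg (eval y) (Chebyshev.U_add_one ℝ ((n : ℤ) + 1))
    have h2 := congrArg (eval y) (Chebyshev.U_add_one ℝ (n : ℤ))
    simp only [eval_sub, eval_mul, eval_X, eval_ofNat, add_sub_cancel_right] at h1 h2 ⊢
    linear_combination ih - (Chebyshev.U ℝ (n : ℤ)).eval y * h1 +
      (Chebyshev.U ℝ ((n : ℤ) + 1)).eval y * h2
  | pred n ih =>
    have h1 := congrArg (eval y) (Chebyshev.U_sub_one ℝ (-(n : ℤ) - 1))
    have h2 := congrArg (eval y) (Chebyshev.U_sub_one ℝ (-(n : ℤ)))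
    simp only [eval_sub, eval_mul, eval_X, eval_ofNat, sub_add_cancel] at h1 h2 ⊢
    linear_combination ih - (Chebyshev.U ℝ (-(n : ℤ))).eval y * h1 +
      (Chebyshev.U ℝ (-(n : ℤ) - 1)).eval y * h2

/-- Differentiating the recurrence at `1` gives a first-order recurrence for the differences. Only
differences enter the derivative at `P₁`, where `x = z = 1`. -/
theorem eval_one_derivative_U_sub (n : ℤ) :
    (Chebyshev.U ℝ n).derivative.eval 1 - (Chebyshev.U ℝ (n - 1)).derivative.eval 1
      = n * (n + 1) := by
  have key (n : ℤ) : (Chebyshev.U ℝ (n + 1)).derivative.eval 1 =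
      2 * (n + 1) + 2 * (Chebyshev.U ℝ n).derivative.eval 1
        - (Chebyshev.U ℝ (n - 1)).derivative.eval 1 := by
    rw [Chebyshev.U_add_one]
    simp [mul_assoc]
    ring
  induction n using Int.induction_on with
  | zero => simp
  | succ n ih =>
    have h := key n
    push_cast at h ih ⊢
    rw [add_sub_cancel_right]
    linear_combination ih + h
  | pred n ih =>
    have h := key (-(n : ℤ) - 1)
    rw [sub_add_cancel] at h
    push_cast at h ih ⊢
    linear_combination ih - h

theorem frickeVogt_T (a : ℕ) (v : R3) : frickeVogt (T a v) = frickeVogt v := by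
  have h1 := eval_U_sq_sub_mul ((a : ℤ) - 1) (v 1)
  have h2 := congrArg (eval (v 1)) (Chebyshev.U_eq ℝ (a : ℤ))
  simp only [eval_sub, eval_mul, eval_X, eval_ofNat, sub_add_cancel, sub_sub] at h1 h2
  norm_num at h1
  simp only [frickeVogt, T, Matrix.cons_val]
  rw [h2] at h1 ⊢
  linear_combination (v 0 ^ 2 + v 2 ^ 2 - 2 * v 0 * v 1 * v 2) * h1

theorem P₁_apply (i : Fin 3) : P₁ i = 1 := by
  fin_cases i <;> simp [P₁]

theorem T_P₁ (a : ℕ) : T a P₁ = P₁ := by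
  ext i
  fin_cases i <;> simp [T, P₁_apply]
  ring

/-- The `i`-th coordinate on `ℝ³`. -/
noncomputable abbrev coord (i : Fin 3) : R3 →L[ℝ] ℝ := ContinuousLinearMap.proj i

theorem hasStrictFDerivAt_coord (i : Fin 3) (v : R3) :
    HasStrictFDerivAt (fun w : R3 => w i) (coord i) v :=
  (coord i).hasStrictFDerivAt

theorem hasStrictFDerivAt_eval_coord (p : ℝ[X]) (i : Fin 3) (v : R3) :
    HasStrictFDerivAt (fun w : R3 => p.eval (w i)) (p.derivative.eval (v i) • coord i) v :=
  have h : HasStrictDerivAt (fun x => p.eval x) (p.derivative.eval (v i)) (coord i v) :=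
    p.hasStrictDerivAt (v i)
  h.comp_hasStrictFDerivAt v (coord i).hasStrictFDerivAt

theorem contDiff_coord (n : WithTop ℕ∞) (i : Fin 3) : ContDiff ℝ n (fun w : R3 => w i) :=
  contDiff_apply ℝ ℝ i

theorem contDiff_eval_coord (n : WithTop ℕ∞) (p : ℝ[X]) (i : Fin 3) :
    ContDiff ℝ n (fun w : R3 => p.eval (w i)) :=
  (by simpa using p.contDiff_aeval (𝕜 := ℝ) n : ContDiff ℝ n fun x => p.eval x).comp
    (contDiff_coord n i)

theorem contDiff_T (n : WithTop ℕ∞) (a : ℕ) : ContDiff ℝ n (T a) := by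
  have hx := contDiff_coord n
  have hp := contDiff_eval_coord n
  refine contDiff_pi.2 fun i => ?_
  fin_cases i
  · exact ((hx 0).mul (hp _ 1)).sub ((hx 2).mul (hp _ 1))
  · exact ((hx 0).mul (hp _ 1)).sub ((hx 2).mul (hp _ 1))
  · exact hx 1

theorem fderiv_T_P₁ (a : ℕ) (v : R3) :
    fderiv ℝ (T a) P₁ v = ![(a + 1) * v 0 + a * (a + 1) * v 1 - a * v 2,
      a * v 0 + (a - 1) * a * v 1 - (a - 1) * v 2, v 1] := by
  have hd : HasFDerivAt (T a) (fderiv ℝ (T a) P₁) P₁ :=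
    ((contDiff_T 1 a).differentiable one_ne_zero P₁).hasFDerivAt
  have hi := hasFDerivAt_pi'.1 hd
  have hx (i : Fin 3) := hasStrictFDerivAt_coord i P₁
  have hp (p : ℝ[X]) := hasStrictFDerivAt_eval_coord p 1 P₁
  have e0 := (hi 0).unique (((hx 0).mul (hp _)).sub ((hx 2).mul (hp _))).hasFDerivAt
  have e1 := (hi 1).unique (((hx 0).mul (hp _)).sub ((hx 2).mul (hp _))).hasFDerivAt
  have e2 := (hi 2).unique (hx 1).hasFDerivAt
  have d0 := eval_one_derivative_U_sub (a : ℤ)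
  have d1 := eval_one_derivative_U_sub ((a : ℤ) - 1)
  replace e0 := DFunLike.congr_fun e0 v
  replace e1 := DFunLike.congr_fun e1 v
  replace e2 := DFunLike.congr_fun e2 v
  simp [P₁_apply] at e0 e1 e2 d0 d1
  rw [sub_sub] at d1
  norm_num at d1
  ext i
  fin_cases i
  · simp
    linear_combination e0 + v 1 * d0
  · simp
    linear_combination e1 + v 1 * d1
  · simpa using e2

/-- The direction of the center manifold. -/
noncomputable def centerDirection (a : ℕ) : R3 := ![-a, 1, -1]

theorem centerDirection_ne_zero (a : ℕ) : centerDirection a ≠ 0 := fun h => by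
  simpa [centerDirection] using congrFun h 1

theorem fderiv_T_centerDirection (a : ℕ) :
    fderiv ℝ (T a) P₁ (centerDirection a) = -centerDirection a := by
  rw [fderiv_T_P₁]
  ext i
  fin_cases i <;> simp [centerDirection] <;> ring

theorem ker_fderiv_T_add_one (a : ℕ) (ha : 1 ≤ a) :
    LinearMap.ker ((fderiv ℝ (T a) P₁ : R3 →ₗ[ℝ] R3) + 1) = ℝ ∙ centerDirection a := by
  have ha' : (a : ℝ) ≠ 0 := by positivity
  ext v
  rw [LinearMap.mem_ker, Submodule.mem_span_singleton, LinearMap.add_apply,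
    ContinuousLinearMap.coe_coe, Module.End.one_apply]
  constructor
  · intro h
    rw [fderiv_T_P₁] at h
    have h1 := congrFun h 1
    have h2 := congrFun h 2
    simp at h1 h2
    refine ⟨v 1, ?_⟩
    ext i
    fin_cases i <;> simp [centerDirection]
    · refine mul_left_cancel₀ ha' ?_
      linear_combination -h1 - (a - 1) * h2
    · linear_combination -h2
  · rintro ⟨c, rfl⟩
    simp [fderiv_T_centerDirection]

/-! ### The center subspace -/

section Center

variable {E : Type*} [NormedAddCommGroup E] [NormedSpace ℝ E]

/-- A root `μ` of `q = X² - bX + 1` with `|μ| = 1` would give `b = |μ² + 1| ≤ 2`. So `q` is coprime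
to `(X - μ)ᵏ`; for `x` in the generalized eigenspace, both polynomials kill `(B + 1) x`, which
therefore vanishes. -/
theorem centerSubspace_eq_ker_add_one (A : E →ₗ[ℝ] E) {b : ℝ} (hb : 2 < b)
    (hA : (A + 1) * (A * A - b • A + 1) = 0) :
    centerSubspace A = LinearMap.ker (A + 1) := by
  set B : End ℂ (TensorProduct ℝ ℂ E) := A.baseChange ℂ with hB
  set q : ℂ[X] := X * X - C (b : ℂ) * X + 1 with hq
  have hBA : B = End.baseChangeHom ℝ ℂ E A := rfl
  have hqB : aeval B q * (B + 1) = 0 := by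
    have := congrArg (End.baseChangeHom ℝ ℂ E) hA
    have hbA : End.baseChangeHom ℝ ℂ E (b • A) = (b : ℂ) • B := by
      ext x
      change (1 : ℂ) ⊗ₜ[ℝ] (b • A x) = (b : ℂ) • ((1 : ℂ) ⊗ₜ[ℝ] A x)
      rw [TensorProduct.tmul_smul, TensorProduct.smul_tmul', TensorProduct.smul_tmul']
      simp
    have e : aeval B q = B * B - (b : ℂ) • B + 1 := by
      simp [hq, Algebra.smul_def]
    rw [map_mul, map_add, map_add, map_sub, map_mul, hbA, map_one, map_zero, ← hBA, ← e] at this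
    rw [show B + 1 = aeval B (X + 1 : ℂ[X]) by simp] at this ⊢
    rw [← map_mul, mul_comm, map_mul, this]
  have hle (μ : {μ : ℂ // ‖μ‖ = 1}) : B.maxGenEigenspace μ ≤ LinearMap.ker (B + 1) := by
    obtain ⟨μ, hμ⟩ := μ
    intro x hx
    obtain ⟨k, hk⟩ := (End.mem_maxGenEigenspace _ _ _).1 hx
    have hqμ : q.eval μ ≠ 0 := by
      intro h0
      simp [hq] at h0
      have : (b : ℂ) * μ = μ * μ + 1 := by linear_combination -h0
      have h3 := congrArg norm this
      have h4 := norm_add_le (μ * μ) 1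
      simp [hμ] at h3 h4
      rw [← h3] at h4
      have := le_abs_self b
      linarith
    have hcop : IsCoprime q ((X - C μ) ^ k) := by
      refine IsCoprime.pow_right ?_
      refine ((irreducible_X_sub_C μ).coprime_iff_not_dvd.2 ?_).symm
      rwa [dvd_iff_isRoot]
    obtain ⟨r, s, hrs⟩ := hcop
    rw [LinearMap.mem_ker]
    have h1 : aeval B q ((B + 1) x) = 0 := by
      rw [← End.mul_apply, hqB, LinearMap.zero_apply]
    have h2 : aeval B ((X - C μ) ^ k) ((B + 1) x) = 0 := by
      have hc : aeval B (X + 1 : ℂ[X]) = B + 1 := by simp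
      have hd : aeval B ((X - C μ) ^ k) x = 0 := by
        simpa [Algebra.algebraMap_eq_smul_one] using hk
      rw [← hc, ← End.mul_apply, ← map_mul, mul_comm, map_mul, End.mul_apply, hd, map_zero]
    generalize (B + 1) x = y at h1 h2 ⊢
    have h3 := congrArg (fun p => aeval B p y) hrs
    simp only [map_add, map_mul, LinearMap.add_apply, End.mul_apply, h1, h2, map_zero, add_zero,
      map_one, End.one_apply] at h3
    exact h3.symm
  ext v
  have hB1 : B ((1 : ℂ) ⊗ₜ[ℝ] v) = (1 : ℂ) ⊗ₜ[ℝ] A v := by simp [hB]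
  rw [centerSubspace, Submodule.mem_comap, Submodule.restrictScalars_mem, LinearMap.mem_ker,
    LinearMap.add_apply, End.one_apply, TensorProduct.mk_apply]
  constructor
  · intro h
    have h1 := iSup_le hle h
    rw [LinearMap.mem_ker, LinearMap.add_apply, End.one_apply, hB1, ← TensorProduct.tmul_add] at h1
    refine Module.FaithfullyFlat.tensorProduct_mk_injective (A := ℝ) (B := ℂ) E ?_
    simpa using h1
  · intro h
    refine Submodule.mem_iSup_of_mem ⟨-1, by simp⟩ (End.eigenspace_le_maxGenEigenspace ?_)
    rw [End.mem_eigenspace_iff, hB1, eq_neg_of_add_eq_zero_left h]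
    simp [TensorProduct.tmul_neg]

end Center

theorem centerSubspace_fderiv_T (a : ℕ) (ha : 1 ≤ a) :
    centerSubspace (fderiv ℝ (T a) P₁ : R3 →ₗ[ℝ] R3) = ℝ ∙ centerDirection a := by
  have ha' : (1 : ℝ) ≤ a := by exact_mod_cast ha
  rw [← ker_fderiv_T_add_one a ha]
  -- The derivative has trace `a² + 1` and determinant `-1`, so the two eigenvalues besides `-1`
  -- have sum `a² + 2` and product `1`.
  refine centerSubspace_eq_ker_add_one _ (b := (a : ℝ) ^ 2 + 2) (by nlinarith) ?_
  refine LinearMap.ext fun v => ?_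
  simp only [End.mul_apply, LinearMap.add_apply, LinearMap.sub_apply, LinearMap.smul_apply,
    ContinuousLinearMap.coe_coe, End.one_apply, fderiv_T_P₁, LinearMap.zero_apply]
  ext i
  fin_cases i <;> simp [Matrix.vecHead, Matrix.vecTail] <;> ring

theorem finrank_centerSubspace_fderiv_T (a : ℕ) (ha : 1 ≤ a) :
    finrank ℝ (centerSubspace (fderiv ℝ (T a) P₁ : R3 →ₗ[ℝ] R3)) = 1 := by
  rw [centerSubspace_fderiv_T a ha, finrank_span_singleton (centerDirection_ne_zero a)]

/-! ### Charts and tangent spaces of submanifolds -/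

section General

variable {E : Type*} [NormedAddCommGroup E] [NormedSpace ℝ E]

theorem exists_hasFDerivAt_equiv {Φ : OpenPartialHomeomorph E E} {x : E} (hx : x ∈ Φ.source)
    (h : DifferentiableAt ℝ Φ x) (h' : DifferentiableAt ℝ Φ.symm (Φ x)) :
    ∃ L : E ≃L[ℝ] E, HasFDerivAt Φ (L : E →L[ℝ] E) x := by
  have h1 : (fderiv ℝ Φ.symm (Φ x)).comp (fderiv ℝ Φ x) = ContinuousLinearMap.id ℝ E := by
    refine (h'.hasFDerivAt.comp x h.hasFDerivAt).unique ?_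
    refine (hasFDerivAt_id x).congr_of_eventuallyEq ?_
    filter_upwards [Φ.eventually_left_inverse hx] with y hy using hy
  have h2 : (fderiv ℝ Φ x).comp (fderiv ℝ Φ.symm (Φ x)) = ContinuousLinearMap.id ℝ E := by
    have h0 := h.hasFDerivAt
    rw [← Φ.left_inv hx] at h0
    have := h0.comp (Φ x) h'.hasFDerivAt
    rw [Φ.left_inv hx] at this
    refine this.unique ((hasFDerivAt_id (Φ x)).congr_of_eventuallyEq ?_)
    filter_upwards [Φ.eventually_right_inverse (Φ.map_source hx)] with y hy using hy
  exact ⟨.equivOfInverse _ _ (DFunLike.congr_fun h1) (DFunLike.congr_fun h2), h.hasFDerivAt⟩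

/-- The curve through `x` that corresponds to a line in the chart `Φ`. -/
noncomputable def chartCurve (Φ : OpenPartialHomeomorph E E) (x w : E) (t : ℝ) : E :=
  Φ.symm (Φ x + t • w)

section ChartCurve

variable {Φ : OpenPartialHomeomorph E E} {x w : E}

theorem chartCurve_zero (hx : x ∈ Φ.source) : chartCurve Φ x w 0 = x := by
  simp [chartCurve, hx]

theorem hasDerivAt_chartCurve (hx : x ∈ Φ.source) {L : E ≃L[ℝ] E}
    (hL : HasFDerivAt Φ (L : E →L[ℝ] E) x) : HasDerivAt (chartCurve Φ x w) (L.symm w) 0 := by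
  have h1 : HasFDerivAt Φ.symm (L.symm : E →L[ℝ] E) (Φ x + (0 : ℝ) • w) := by
    simp only [zero_smul, add_zero]
    refine Φ.hasFDerivAt_symm (Φ.map_source hx) ?_
    rwa [Φ.left_inv hx]
  have h2 : HasDerivAt (fun t : ℝ => Φ x + t • w) w 0 := by
    simpa using ((hasDerivAt_id (0 : ℝ)).smul_const w).const_add (Φ x)
  exact h1.comp_hasDerivAt 0 h2

theorem tendsto_line (x w : E) : Filter.Tendsto (fun t : ℝ => x + t • w) (𝓝 0) (𝓝 x) := by
  have : Continuous fun t : ℝ => x + t • w := by fun_prop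
  simpa using this.tendsto 0

theorem eventually_chartCurve_mem (hx : x ∈ Φ.source) {W : Set E} {F : Submodule ℝ E}
    (hW : ∀ y ∈ Φ.source, y ∈ W ↔ Φ y ∈ F) (hxW : x ∈ W) (hw : w ∈ F) :
    ∀ᶠ t in 𝓝 (0 : ℝ), chartCurve Φ x w t ∈ W := by
  filter_upwards [(tendsto_line (Φ x) w).eventually
    (Φ.open_target.mem_nhds (Φ.map_source hx))] with t ht
  rw [chartCurve, hW _ (Φ.map_target ht), Φ.right_inv ht]
  exact F.add_mem ((hW x hx).1 hxW) (F.smul_mem t hw)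

theorem tangentSpace_eq_comap [FiniteDimensional ℝ E] (hx : x ∈ Φ.source) {L : E ≃L[ℝ] E}
    (hL : HasFDerivAt Φ (L : E →L[ℝ] E) x) {W : Set E} {F : Submodule ℝ E}
    (hW : ∀ y ∈ Φ.source, y ∈ W ↔ Φ y ∈ F) (hxW : x ∈ W) :
    tangentSpace W x = F.comap (L : E →ₗ[ℝ] E) := by
  refine le_antisymm (Submodule.span_le.2 ?_) fun v hv => Submodule.subset_span ?_
  · rintro v ⟨γ, rfl, hγW, hγ⟩
    have hd := hL.comp_hasDerivAt 0 hγ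
    have hs : ∀ᶠ t in 𝓝 (0 : ℝ), γ t ∈ Φ.source :=
      hγ.continuousAt.eventually (Φ.open_source.mem_nhds hx)
    refine F.closed_of_finiteDimensional.mem_of_tendsto hd.tendsto_slope ?_
    refine Filter.Eventually.filter_mono nhdsWithin_le_nhds ?_
    filter_upwards [hγW, hs] with t ht hts
    exact F.smul_mem _ (F.sub_mem ((hW _ hts).1 ht) ((hW _ hx).1 hxW))
  · refine ⟨chartCurve Φ x (L v), chartCurve_zero hx, eventually_chartCurve_mem hx hW hxW hv, ?_⟩
    simpa using hasDerivAt_chartCurve (w := L v) hx hL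

end ChartCurve

/-- The inverse is known to be regular only at `f x`, so the target is cut down to an open set where
this persists. Class `ω` matters: `ContDiffAt` of order `∞` need not spread to a neighborhood, as
the neighborhood may shrink with the order. -/
theorem exists_chart [CompleteSpace E] {f : E → E} {L : E ≃L[ℝ] E} {x : E} (hf : ContDiff ℝ ω f)
    (hL : HasFDerivAt f (L : E →L[ℝ] E) x) :
    ∃ Φ : OpenPartialHomeomorph E E, x ∈ Φ.source ∧ ⇑Φ = f ∧ ContDiffOn ℝ ω Φ.symm Φ.target := by
  set Ψ := hf.contDiffAt.toOpenPartialHomeomorph f hL (by simp)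
  have hxΨ : x ∈ Ψ.source := hf.contDiffAt.mem_toOpenPartialHomeomorph_source hL (by simp)
  have hs : ContDiffAt ℝ ω Ψ.symm (f x) := hf.contDiffAt.to_localInverse hL (by simp)
  obtain ⟨U, hU, hUo, hxU⟩ := eventually_nhds_iff.1 (hs.eventually (by simp))
  refine ⟨(Ψ.symm.restrOpen U hUo).symm, ?_, rfl, ?_⟩
  · simpa using ⟨hxΨ, hxU⟩
  · intro y hy
    simp at hy
    exact (hU y hy.2).contDiffWithinAt

end General

/-! ### A smooth center manifold made of points of period two -/

/-- A local diffeomorphism at `P₁` whose first two components vanish exactly at the points of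
period two of `T a`. -/
noncomputable def periodTwoChart (a : ℕ) (v : R3) : R3 :=
  ![v 0 * (Chebyshev.U ℝ ((a : ℤ) - 1)).eval (v 1)
      - v 2 * (1 + (Chebyshev.U ℝ ((a : ℤ) - 2)).eval (v 1)),
    (2 * v 1 * v 2 - v 0) * (Chebyshev.U ℝ ((a : ℤ) - 1)).eval (v 2)
      - v 1 * (1 + (Chebyshev.U ℝ ((a : ℤ) - 2)).eval (v 2)),
    v 2 - 1]

theorem contDiff_periodTwoChart (n : WithTop ℕ∞) (a : ℕ) : ContDiff ℝ n (periodTwoChart a) := by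
  have hx := contDiff_coord n
  have hp := contDiff_eval_coord n
  refine contDiff_pi.2 fun i => ?_
  fin_cases i
  · exact ((hx 0).mul (hp _ 1)).sub ((hx 2).mul (contDiff_const.add (hp _ 1)))
  · exact ((((contDiff_const.mul (hx 1)).mul (hx 2)).sub (hx 0)).mul (hp _ 2)).sub
      ((hx 1).mul (contDiff_const.add (hp _ 2)))
  · exact (hx 2).sub contDiff_const

theorem fderiv_periodTwoChart_P₁ (a : ℕ) (v : R3) :
    fderiv ℝ (periodTwoChart a) P₁ v = ![a * v 0 + a * (a - 1) * v 1 - a * v 2,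
      -a * v 0 + a * v 1 + a * (a + 1) * v 2, v 2] := by
  have hd : HasFDerivAt (periodTwoChart a) (fderiv ℝ (periodTwoChart a) P₁) P₁ :=
    ((contDiff_periodTwoChart 1 a).differentiable one_ne_zero P₁).hasFDerivAt
  have hi := hasFDerivAt_pi'.1 hd
  have hx (i : Fin 3) := hasStrictFDerivAt_coord i P₁
  have hp (p : ℝ[X]) (i : Fin 3) := hasStrictFDerivAt_eval_coord p i P₁
  have e0 := (hi 0).unique
    (((hx 0).mul (hp _ 1)).sub ((hx 2).mul ((hp _ 1).const_add 1))).hasFDerivAt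
  have e1 := (hi 1).unique (((((((hx 1).const_mul 2).mul (hx 2)).sub (hx 0)).mul (hp _ 2)).sub
    ((hx 1).mul ((hp _ 2).const_add 1)))).hasFDerivAt
  have e2 := (hi 2).unique ((hx 2).sub_const 1).hasFDerivAt
  have d1 := eval_one_derivative_U_sub ((a : ℤ) - 1)
  replace e0 := DFunLike.congr_fun e0 v
  replace e1 := DFunLike.congr_fun e1 v
  replace e2 := DFunLike.congr_fun e2 v
  simp [P₁_apply] at e0 e1 e2 d1
  rw [sub_sub] at d1
  norm_num at d1
  ext i
  fin_cases i
  · simp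
    linear_combination e0 + v 1 * d1
  · simp
    linear_combination e1 + v 2 * d1
  · simpa using e2

theorem exists_hasFDerivAt_periodTwoChart (a : ℕ) (ha : 1 ≤ a) :
    ∃ L : R3 ≃L[ℝ] R3, HasFDerivAt (periodTwoChart a) (L : R3 →L[ℝ] R3) P₁ := by
  have ha' : (a : ℝ) ≠ 0 := by positivity
  have hd : HasFDerivAt (periodTwoChart a) (fderiv ℝ (periodTwoChart a) P₁) P₁ :=
    ((contDiff_periodTwoChart 1 a).differentiable one_ne_zero P₁).hasFDerivAt
  have hinj : Function.Injective (fderiv ℝ (periodTwoChart a) P₁ : R3 →ₗ[ℝ] R3) := by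
    refine (injective_iff_map_eq_zero _).2 fun v hv => ?_
    rw [ContinuousLinearMap.coe_coe, fderiv_periodTwoChart_P₁] at hv
    have h0 := congrFun hv 0
    have h1 := congrFun hv 1
    have h2 := congrFun hv 2
    simp at h0 h1 h2
    have h3 : v 1 = 0 := by
      refine mul_left_cancel₀ (mul_ne_zero ha' ha') ?_
      linear_combination h0 + h1 - a ^ 2 * h2
    have h4 : v 0 = 0 := by
      refine mul_left_cancel₀ ha' ?_
      linear_combination h0 + a * h2 - a * (a - 1) * h3
    ext i
    fin_cases i <;> assumption
  exact ⟨(LinearEquiv.ofInjectiveEndo _ hinj).toContinuousLinearEquiv, hd⟩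

/-- The first equation says that `T a` swaps `y` and `z`; after cancelling `U_{a-1}(y)` it also
gives `x ↦ 2yz - x`. The second equation is the first one at `(2yz - x, z, y)`, so `T a` exchanges
the two. -/
theorem periodTwoChart_T {a : ℕ} {v : R3}
    (hU : (Chebyshev.U ℝ ((a : ℤ) - 1)).eval (v 1) ≠ 0)
    (h0 : periodTwoChart a v 0 = 0) (h1 : periodTwoChart a v 1 = 0) :
    periodTwoChart a (T a v) 0 = 0 ∧ periodTwoChart a (T a v) 1 = 0 := by
  have k1 := eval_U_sq_sub_mul ((a : ℤ) - 1) (v 1)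
  have k2 := congrArg (eval (v 1)) (Chebyshev.U_eq ℝ (a : ℤ))
  simp only [eval_sub, eval_mul, eval_X, eval_ofNat, sub_add_cancel, sub_sub] at k1 k2
  norm_num at k1
  have t1 : T a v 1 = v 2 := by
    simp only [T, periodTwoChart, Matrix.cons_val] at h0 ⊢
    linear_combination h0
  have t2 : T a v 2 = v 1 := by simp [T]
  have t0 : T a v 0 = 2 * v 1 * v 2 - v 0 := by
    refine mul_left_cancel₀ hU ?_
    simp only [T, periodTwoChart, Matrix.cons_val] at h0 ⊢
    rw [k2] at k1 ⊢
    linear_combination (2 * v 1 * (Chebyshev.U ℝ ((a : ℤ) - 1)).eval (v 1) -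
      (Chebyshev.U ℝ ((a : ℤ) - 2)).eval (v 1) + 1) * h0 - v 2 * k1
  simp only [periodTwoChart, t0, t1, t2, Matrix.cons_val] at h0 h1 ⊢
  constructor
  · linear_combination h1
  · linear_combination h0

theorem exists_isCenterManifold (a : ℕ) (ha : 1 ≤ a) :
    ∃ W : Set R3, IsCenterManifold ∞ (T a) P₁ W := by
  obtain ⟨L, hL⟩ := exists_hasFDerivAt_periodTwoChart a ha
  obtain ⟨Φ, hx, hΦ, hΦs⟩ := exists_chart (contDiff_periodTwoChart ω a) hL
  -- This is the third axis; writing it as an image makes the tangent space at `P₁` the center line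
  -- at once.
  set F : Submodule ℝ R3 := (ℝ ∙ centerDirection a).map (L : R3 →ₗ[ℝ] R3) with hF
  have hmem (w : R3) : w ∈ F ↔ w 0 = 0 ∧ w 1 = 0 := by
    have hLe : (L : R3 →ₗ[ℝ] R3) (centerDirection a) = ![0, 0, -1] := by
      change (L : R3 →L[ℝ] R3) (centerDirection a) = _
      rw [← hL.fderiv, fderiv_periodTwoChart_P₁]
      ext i
      fin_cases i <;> simp [centerDirection] <;> ring
    rw [hF, Submodule.map_span, image_singleton, hLe,
      Submodule.mem_span_singleton]
    constructor
    · rintro ⟨c, rfl⟩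
      simp
    · rintro ⟨h0, h1⟩
      refine ⟨-w 2, ?_⟩
      ext i
      fin_cases i <;> simp [h0, h1]
  have hrank : finrank ℝ F = 1 := by
    rw [hF, LinearEquiv.finrank_map_eq L.toLinearEquiv,
      finrank_span_singleton (centerDirection_ne_zero a)]
  set W : Set R3 := {v ∈ Φ.source | Φ v ∈ F} with hW
  have hWF : ∀ y ∈ Φ.source, y ∈ W ↔ Φ y ∈ F := fun y hy => by simp [hW, hy]
  have hP : P₁ ∈ W := by
    refine (hWF _ hx).2 ((hmem _).2 ?_)
    rw [hΦ]
    constructor <;> simp [periodTwoChart, P₁_apply] <;> ring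
  refine ⟨W, T_P₁ a, hP, ?_, ?_, ?_⟩
  · rw [finrank_centerSubspace_fderiv_T a ha]
    intro x hxW
    refine ⟨Φ, F, hxW.1, ?_, hΦs.of_le le_top, hrank, hWF⟩
    rw [hΦ]
    exact (contDiff_periodTwoChart ∞ a).contDiffOn
  · rw [centerSubspace_fderiv_T a ha,
      tangentSpace_eq_comap hx (L := L) (by rwa [hΦ]) hWF hP, hF,
      Submodule.comap_map_eq_of_injective L.injective]
  · have hT : ∀ᶠ v in 𝓝 P₁, T a v ∈ Φ.source := by
      refine (contDiff_T 1 a).continuous.continuousAt.eventually (Φ.open_source.mem_nhds ?_)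
      rwa [T_P₁]
    have hU : ∀ᶠ v in 𝓝 P₁, (Chebyshev.U ℝ ((a : ℤ) - 1)).eval (v 1) ≠ 0 := by
      refine (contDiff_eval_coord 1 _ 1).continuous.continuousAt.eventually_ne ?_
      rw [P₁_apply, Chebyshev.U_eval_one]
      push_cast
      rw [sub_add_cancel]
      positivity
    filter_upwards [hT, hU] with v hv hUv hvW
    rw [hWF _ hv, hmem, hΦ]
    have := (hmem _).1 hvW.2
    rw [hΦ] at this
    exact periodTwoChart_T hUv this.1 this.2

/-! ### Transversality to level sets -/

section General

variable {E : Type*} [NormedAddCommGroup E] [NormedSpace ℝ E]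

theorem ker_le_tangentSpace_levelSet [CompleteSpace E] {f : E → ℝ} {f' : E →L[ℝ] ℝ} {x : E}
    (hf : HasStrictFDerivAt f f' x) (hf' : f' ≠ 0) :
    LinearMap.ker (f' : E →ₗ[ℝ] ℝ) ≤ tangentSpace {y | f y = f x} x := by
  have hr : f'.range = ⊤ := by
    refine LinearMap.range_eq_top.2 (LinearMap.surjective ?_)
    exact fun h => hf' (ContinuousLinearMap.coe_injective h)
  intro v hv
  have hline : HasDerivAt (fun t : ℝ => t • (⟨v, hv⟩ : f'.ker)) ⟨v, hv⟩ 0 := by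
    simpa using (hasDerivAt_id (0 : ℝ)).smul_const (⟨v, hv⟩ : f'.ker)
  refine Submodule.subset_span
    ⟨fun t => hf.implicitFunction f f' hr (f x) (t • ⟨v, hv⟩), by simp, ?_, ?_⟩
  · have h1 : Filter.Tendsto (fun t : ℝ => (f x, t • (⟨v, hv⟩ : f'.ker))) (𝓝 0)
        (𝓝 (f x, 0)) := by
      refine tendsto_const_nhds.prodMk_nhds ?_
      simpa using hline.continuousAt.tendsto
    exact h1.eventually (hf.map_implicitFunction_eq hr)
  · have h2 := (hf.to_implicitFunction hr).hasFDerivAt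
    rw [← zero_smul ℝ (⟨v, hv⟩ : f'.ker)] at h2
    exact h2.comp_hasDerivAt 0 hline

/-- The level set already contributes the hyperplane `ker f'`, so one tangent vector of `W` outside
it suffices. -/
theorem transversalAt_levelSet [CompleteSpace E] {f : E → ℝ} {f' : E →L[ℝ] ℝ} {x : E}
    (hf : HasStrictFDerivAt f f' x) {W : Set E} {v : E} (hv : v ∈ tangentSpace W x)
    (hfv : f' v ≠ 0) : TransversalAt W {y | f y = f x} x := by
  have hf' : f' ≠ 0 := fun h => hfv (by simp [h])
  rw [TransversalAt, eq_top_iff]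
  intro w _
  have hw : w - (f' w / f' v) • v ∈ LinearMap.ker (f' : E →ₗ[ℝ] ℝ) := by
    simp [hfv]
  have := Submodule.add_mem_sup (Submodule.smul_mem _ (f' w / f' v) hv)
    (ker_le_tangentSpace_levelSet hf hf' hw)
  rwa [add_sub_cancel] at this

end General

/-! ### The invariant and the map along a center manifold -/

/-- The derivative of the Fricke–Vogt invariant. -/
noncomputable def frickeVogtDeriv (v : R3) : R3 →L[ℝ] ℝ :=
  (2 * v 0 - 2 * v 1 * v 2) • coord 0 + (2 * v 1 - 2 * v 0 * v 2) • coord 1 +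
    (2 * v 2 - 2 * v 0 * v 1) • coord 2

theorem hasStrictFDerivAt_frickeVogt (v : R3) :
    HasStrictFDerivAt frickeVogt (frickeVogtDeriv v) v := by
  have hx (i : Fin 3) := hasStrictFDerivAt_coord i v
  refine ((((((hx 0).pow 2).add ((hx 1).pow 2)).add ((hx 2).pow 2)).sub
    ((((hx 0).const_mul 2).mul (hx 1)).mul (hx 2))).sub_const 1).congr_fderiv ?_
  ext w
  simp [frickeVogtDeriv]
  ring

theorem frickeVogt_P₁ : frickeVogt P₁ = 0 := by
  simp [frickeVogt, P₁_apply]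
  norm_num

/-- A chart line in the center direction gives `γ`. Since that direction has second coordinate `1`,
the second coordinate read through `L⁻¹ ∘ Φ` recovers the parameter. -/
theorem exists_curve (a : ℕ) (ha : 1 ≤ a) {W : Set R3} (hW : IsCenterManifold 1 (T a) P₁ W) :
    ∃ (γ : ℝ → R3) (s : R3 → ℝ), γ 0 = P₁ ∧ ContDiffAt ℝ 1 γ 0 ∧
      HasDerivAt γ (centerDirection a) 0 ∧ HasFDerivAt s (coord 1) P₁ ∧
      (∀ᶠ t in 𝓝 0, γ t ∈ W ∧ s (γ t) = t) ∧ ∀ᶠ x in 𝓝 P₁, x ∈ W → γ (s x) = x := by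
  obtain ⟨Φ, F, hx, h1, h2, -, hF⟩ := hW.submanifold P₁ hW.mem
  have hs : ContDiffAt ℝ 1 Φ.symm (Φ P₁) :=
    h2.contDiffAt (Φ.open_target.mem_nhds (Φ.map_source hx))
  obtain ⟨L, hL⟩ := exists_hasFDerivAt_equiv hx
    ((h1.contDiffAt (Φ.open_source.mem_nhds hx)).differentiableAt one_ne_zero)
    (hs.differentiableAt one_ne_zero)
  have ht := hW.tangent
  rw [centerSubspace_fderiv_T a ha, tangentSpace_eq_comap hx hL hF hW.mem] at ht
  have hmem (v : R3) : L v ∈ F ↔ ∃ c : ℝ, c • centerDirection a = v := by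
    rw [← Submodule.mem_span_singleton, ← ht]
    rfl
  have heF : L (centerDirection a) ∈ F := (hmem _).2 ⟨1, one_smul _ _⟩
  refine ⟨chartCurve Φ P₁ (L (centerDirection a)), fun x => L.symm (Φ x - Φ P₁) 1,
    chartCurve_zero hx, ?_, ?_, ?_, ?_, ?_⟩
  · refine ContDiffAt.comp (0 : ℝ) (g := Φ.symm)
      (f := fun t : ℝ => Φ P₁ + t • L (centerDirection a)) (by simpa using hs) ?_
    fun_prop
  · simpa using hasDerivAt_chartCurve (w := L (centerDirection a)) hx hL
  · have := ((coord 1).comp (L.symm : R3 →L[ℝ] R3)).hasFDerivAt.comp P₁ (hL.sub_const (Φ P₁))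
    refine this.congr_fderiv ?_
    ext v
    simp
  · filter_upwards [eventually_chartCurve_mem hx hF hW.mem heF,
      (tendsto_line (Φ P₁) (L (centerDirection a))).eventually
        (Φ.open_target.mem_nhds (Φ.map_source hx))] with t ht htt
    refine ⟨ht, ?_⟩
    rw [chartCurve, Φ.right_inv htt]
    simp [centerDirection]
  · filter_upwards [Φ.open_source.mem_nhds hx] with x hxs hxW
    have hd : L (L.symm (Φ x - Φ P₁)) ∈ F := by
      rw [L.apply_symm_apply]
      exact F.sub_mem ((hF x hxs).1 hxW) ((hF _ hx).1 hW.mem)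
    obtain ⟨c, hc⟩ := (hmem _).1 hd
    have hc' : L.symm (Φ x - Φ P₁) 1 = c := by
      rw [← hc]
      simp [centerDirection]
    rw [chartCurve, hc', ← map_smul, hc, L.apply_symm_apply, add_sub_cancel, Φ.left_inv hxs]

/-- As `γ` is only `C¹`, a second derivative of `I ∘ γ` is not available. But the gradient of `I`
vanishes at `P₁`, so `(I ∘ γ)' (t) / t` tends to the Hessian of `I` on the center direction, which
is `2a² + 8`. -/
theorem eventually_mul_deriv_pos (a : ℕ) {γ : ℝ → R3} (h0 : γ 0 = P₁)
    (hγ : ContDiffAt ℝ 1 γ 0) (hγ' : HasDerivAt γ (centerDirection a) 0) :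
    ∀ᶠ t in 𝓝 (0 : ℝ), t ≠ 0 → 0 < t * frickeVogtDeriv (γ t) (deriv γ t) := by
  have hcoord (i : Fin 3) : HasDerivAt (fun t => γ t i) (centerDirection a i) 0 :=
    hasDerivAt_pi.1 hγ' i
  have hcont : Filter.Tendsto (deriv γ) (𝓝[≠] 0) (𝓝 (centerDirection a)) := by
    have h1 : ContinuousAt (deriv γ) 0 := by
      have := (hγ.continuousAt_fderiv one_ne_zero).clm_apply
        (continuousAt_const (y := (1 : ℝ)))
      simpa [fderiv_apply_one_eq_deriv] using this
    rw [ContinuousAt, hγ'.deriv] at h1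
    exact h1.mono_left nhdsWithin_le_nhds
  have hc (i : Fin 3) := (tendsto_pi_nhds.1 hcont) i
  have d0 := ((hcoord 0).const_mul 2).sub (((hcoord 1).const_mul 2).mul (hcoord 2))
  have d1 := ((hcoord 1).const_mul 2).sub (((hcoord 0).const_mul 2).mul (hcoord 2))
  have d2 := ((hcoord 2).const_mul 2).sub (((hcoord 0).const_mul 2).mul (hcoord 1))
  have hlim := ((d0.tendsto_slope.mul (hc 0)).add (d1.tendsto_slope.mul (hc 1))).add
    (d2.tendsto_slope.mul (hc 2))
  have hpos := hlim.eventually (lt_mem_nhds (a := 0) (by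
    simp [h0, P₁_apply, centerDirection]
    nlinarith [sq_nonneg (a : ℝ)]))
  filter_upwards [eventually_nhdsWithin_iff.1 hpos] with t ht htne
  have h2 := ht htne
  have e : t * frickeVogtDeriv (γ t) (deriv γ t) = t ^ 2 *
      (slope (fun t => 2 * γ t 0 - 2 * γ t 1 * γ t 2) 0 t * deriv γ t 0 +
        slope (fun t => 2 * γ t 1 - 2 * γ t 0 * γ t 2) 0 t * deriv γ t 1 +
        slope (fun t => 2 * γ t 2 - 2 * γ t 0 * γ t 1) 0 t * deriv γ t 2) := by
    simp [slope_def_field, h0, P₁_apply, frickeVogtDeriv]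
    field_simp
  rw [e]
  exact mul_pos (by positivity) h2

/-- A function whose derivative has the sign of the variable is injective on each side of `0`. -/
theorem eq_of_apply_eq_of_mul_deriv_pos {h h' : ℝ → ℝ} {δ : ℝ}
    (hh : ∀ t, |t| < δ → HasDerivAt h (h' t) t ∧ (t ≠ 0 → 0 < t * h' t)) {t u : ℝ}
    (ht : |t| < δ) (hu : |u| < δ) (htu : 0 < t * u) (heq : h t = h u) : t = u := by
  have hcont (D : Set ℝ) (hD : ∀ x ∈ D, |x| < δ) : ContinuousOn h D := fun x hx =>
    (hh x (hD x hx)).1.continuousAt.continuousWithinAt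
  rcases pos_and_pos_or_neg_and_neg_of_mul_pos htu with ⟨h1, h2⟩ | ⟨h1, h2⟩
  · have hD (x : ℝ) (hx : x ∈ Ioo 0 δ) : |x| < δ := by
      rw [abs_of_pos hx.1]; exact hx.2
    have hmono : StrictMonoOn h (Ioo 0 δ) := by
      refine strictMonoOn_of_deriv_pos (convex_Ioo _ _) (hcont _ hD) fun x hx => ?_
      rw [interior_Ioo] at hx
      rw [(hh x (hD x hx)).1.deriv]
      exact pos_of_mul_pos_right ((hh x (hD x hx)).2 hx.1.ne') hx.1.le
    exact hmono.injOn ⟨h1, (le_abs_self t).trans_lt ht⟩ ⟨h2, (le_abs_self u).trans_lt hu⟩ heq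
  · have hD (x : ℝ) (hx : x ∈ Ioo (-δ) 0) : |x| < δ := by
      rw [abs_of_neg hx.2]; linarith [hx.1]
    have hanti : StrictAntiOn h (Ioo (-δ) 0) := by
      refine strictAntiOn_of_deriv_neg (convex_Ioo _ _) (hcont _ hD) fun x hx => ?_
      rw [interior_Ioo] at hx
      rw [(hh x (hD x hx)).1.deriv]
      exact neg_of_mul_pos_right ((hh x (hD x hx)).2 hx.2.ne) hx.2.le
    exact hanti.injOn ⟨(abs_lt.1 ht).1, h1⟩ ⟨(abs_lt.1 hu).1, h2⟩ heq

/-- Near `P₁` a center manifold of class `C¹` is a curve `γ` with parameter `s`, on which the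
Fricke–Vogt invariant has a nondegenerate minimum at `P₁`, and on which `T a` acts as an
involution `τ` that reverses the orientation. -/
theorem exists_curve_involution (a : ℕ) (ha : 1 ≤ a) {W : Set R3}
    (hW : IsCenterManifold 1 (T a) P₁ W) :
    ∃ (γ : ℝ → R3) (s : R3 → ℝ) (τ : ℝ → ℝ) (δ₁ δ : ℝ), 0 < δ ∧ δ ≤ δ₁ ∧ γ 0 = P₁ ∧
      ContinuousAt γ 0 ∧ ContinuousAt s P₁ ∧ s P₁ = 0 ∧ (∀ᶠ x in 𝓝 P₁, x ∈ W → γ (s x) = x) ∧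
      (∀ t, |t| < δ₁ → γ t ∈ W ∧ s (γ t) = t ∧ DifferentiableAt ℝ γ t ∧
        (t ≠ 0 → 0 < t * frickeVogtDeriv (γ t) (deriv γ t))) ∧
      ∀ t, |t| < δ → |τ t| < δ₁ ∧ T a (γ t) = γ (τ t) ∧ T a (γ (τ t)) = γ t ∧
        (t ≠ 0 → t * τ t < 0) := by
  obtain ⟨γ, s, h0, hγ, hγ', hs, hγW, hWγ⟩ := exists_curve a ha hW
  have hs0 : s P₁ = 0 := by simpa [h0] using hγW.self_of_nhds.2
  have hγc : Filter.Tendsto γ (𝓝 0) (𝓝 P₁) := by simpa [h0] using hγ.continuousAt.tendsto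
  have hdiff : ∀ᶠ t in 𝓝 (0 : ℝ), DifferentiableAt ℝ γ t :=
    (hγ.eventually (by simp)).mono fun t ht => ht.differentiableAt one_ne_zero
  obtain ⟨δ₁, hδ₁, hball⟩ := Metric.eventually_nhds_iff.1
    (hγW.and (hdiff.and (eventually_mul_deriv_pos a h0 hγ hγ')))
  simp only [dist_zero_right, Real.norm_eq_abs] at hball
  have hTc : Filter.Tendsto (T a) (𝓝 P₁) (𝓝 P₁) := by
    simpa only [T_P₁] using (contDiff_T 1 a).continuous.tendsto P₁
  set τ : ℝ → ℝ := fun t => s (T a (γ t)) with hτ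
  have hτ0 : τ 0 = 0 := by simp [hτ, h0, T_P₁, hs0]
  have hτ' : HasDerivAt τ (-1) 0 := by
    have hT : HasFDerivAt (T a) (fderiv ℝ (T a) P₁) (γ 0) := by
      rw [h0]
      exact ((contDiff_T 1 a).differentiable one_ne_zero P₁).hasFDerivAt
    have h1 := hT.comp_hasDerivAt 0 hγ'
    rw [fderiv_T_centerDirection] at h1
    have h2 : HasFDerivAt s (coord 1) ((T a ∘ γ) 0) := by
      simpa [h0, T_P₁] using hs
    have h3 := h2.comp_hasDerivAt 0 h1
    rwa [show coord 1 (-centerDirection a) = -1 by simp [centerDirection]] at h3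
  have hτc : Filter.Tendsto τ (𝓝 0) (𝓝 0) := by
    simpa [hτ0] using hτ'.continuousAt.tendsto
  have hsign : ∀ᶠ t in 𝓝 (0 : ℝ), t ≠ 0 → t * τ t < 0 := by
    have := hτ'.tendsto_slope.eventually (gt_mem_nhds (neg_one_lt_zero (R := ℝ)))
    filter_upwards [eventually_nhdsWithin_iff.1 this] with t ht htne
    have h1 := ht htne
    rw [slope_def_field, hτ0, sub_zero, sub_zero] at h1
    have h2 : t * τ t = t ^ 2 * (τ t / t) := by field_simp
    rw [h2]
    exact mul_neg_of_pos_of_neg (by positivity) h1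
  have hTγ : ∀ᶠ t in 𝓝 (0 : ℝ), T a (γ t) = γ (τ t) := by
    filter_upwards [hγW, hγc.eventually hW.invariant, (hTc.comp hγc).eventually hWγ]
      with t h1 h2 h3
    exact (h3 (h2 h1.1)).symm
  have hlt : ∀ᶠ t in 𝓝 (0 : ℝ), |t| < δ₁ :=
    (continuous_abs.tendsto' (0 : ℝ) 0 abs_zero).eventually (gt_mem_nhds hδ₁)
  -- These facts are required at `t`, `τ t` and `τ (τ t)`, hence a second, smaller radius.
  have hall := hlt.and (hsign.and hTγ)
  obtain ⟨δ₂, hδ₂, hball₂⟩ := Metric.eventually_nhds_iff.1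
    (hall.and ((hτc.eventually hall).and ((hτc.comp hτc).eventually hall)))
  simp only [dist_zero_right, Real.norm_eq_abs, Function.comp_apply] at hball₂
  refine ⟨γ, s, τ, δ₁, min δ₁ δ₂, lt_min hδ₁ hδ₂, min_le_left _ _, h0, hγ.continuousAt,
    hs.continuousAt, hs0, hWγ, fun t ht => ⟨(hball ht).1.1, (hball ht).1.2, (hball ht).2⟩,
    fun t ht => ?_⟩
  obtain ⟨⟨h1, h2, h3⟩, ⟨h4, h5, h6⟩, h7, -, -⟩ := hball₂ (ht.trans_le (min_le_right _ _))
  refine ⟨h4, h3, ?_, h2⟩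
  rw [h6]
  rcases eq_or_ne t 0 with rfl | htne
  · rw [hτ0, hτ0]
  · have hneg := h2 htne
    have hτne : τ t ≠ 0 := fun h => by simp [h] at hneg
    have hneg' := h5 hτne
    -- Two sign changes put `τ (τ t)` on the side of `t`, and the levels of `I` agree.
    refine congrArg γ (eq_of_apply_eq_of_mul_deriv_pos (h := fun t => frickeVogt (γ t))
      (h' := fun t => frickeVogtDeriv (γ t) (deriv γ t)) (δ := δ₁) (fun u hu => ⟨?_, ?_⟩)
      h7 h1 ?_ ?_)
    · exact (hasStrictFDerivAt_frickeVogt _).hasFDerivAt.comp_hasDerivAt u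
        (hball hu).2.1.hasDerivAt
    · exact (hball hu).2.2
    · have : 0 < (t * τ t) * (τ t * τ (τ t)) := mul_pos_of_neg_of_neg hneg hneg'
      have h8 : (t * τ t) * (τ t * τ (τ t)) = (τ t) ^ 2 * (τ (τ t) * t) := by ring
      rw [h8] at this
      exact pos_of_mul_pos_right this (sq_nonneg _)
    · show frickeVogt _ = frickeVogt _
      rw [← h6, frickeVogt_T, ← h3, frickeVogt_T]

/-! ### Period two and the intersection with level surfaces -/

theorem isEmbeddedSubmanifold_and_dynamics (a : ℕ) (ha : 1 ≤ a) (W : Set R3)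
    (hW : IsCenterManifold 1 (T a) P₁ W) :
    IsEmbeddedSubmanifold 1 1 W ∧
      ∃ V₀ ∈ 𝓝 P₁,
        (∀ x ∈ W ∩ V₀, x ≠ P₁ → Function.minimalPeriod (T a) x = 2) ∧
        ∀ V ∈ 𝓝 P₁, V ⊆ V₀ →
          ∃ lam₀ : ℝ, 0 < lam₀ ∧ ∀ lam : ℝ, 0 < lam → lam < lam₀ →
            (∀ x ∈ W ∩ S lam ∩ V, TransversalAt W (S lam) x) ∧
            ∃ p q : R3, p ≠ q ∧ W ∩ S lam ∩ V = {p, q} ∧ T a '' {p, q} = {p, q} := by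
  refine ⟨finrank_centerSubspace_fderiv_T a ha ▸ hW.submanifold, ?_⟩
  obtain ⟨γ, s, τ, δ₁, δ, hδ, hδ₁, h0, hγc, hsc, hs0, hWγ, hγ, hτ⟩ :=
    exists_curve_involution a ha hW
  set h : ℝ → ℝ := fun t => frickeVogt (γ t) with hh
  have hh' (t : ℝ) (ht : |t| < δ₁) :
      HasDerivAt h (frickeVogtDeriv (γ t) (deriv γ t)) t ∧
        (t ≠ 0 → 0 < t * frickeVogtDeriv (γ t) (deriv γ t)) :=
    ⟨(hasStrictFDerivAt_frickeVogt _).hasFDerivAt.comp_hasDerivAt t (hγ t ht).2.2.1.hasDerivAt,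
      (hγ t ht).2.2.2⟩
  have hinj {t u : ℝ} (ht : |t| < δ₁) (hu : |u| < δ₁) (htu : 0 < t * u) (heq : h t = h u) :
      t = u := eq_of_apply_eq_of_mul_deriv_pos hh' ht hu htu heq
  have hh0 : h 0 = 0 := by simp [hh, h0, frickeVogt_P₁]
  have hsmall : ∀ᶠ x in 𝓝 P₁, |s x| < δ := by
    have : Filter.Tendsto (fun x => |s x|) (𝓝 P₁) (𝓝 0) := by
      simpa [hs0] using hsc.abs.tendsto
    exact this.eventually (gt_mem_nhds hδ)
  refine ⟨{x | (x ∈ W → γ (s x) = x) ∧ |s x| < δ}, hWγ.and hsmall, ?_, ?_⟩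
  · rintro x ⟨hxW, hx, hxδ⟩ hxP
    have hx := hx hxW
    have hne : s x ≠ 0 := fun h => hxP (by rw [← hx, h, h0])
    obtain ⟨h1, h2, h3, h4⟩ := hτ (s x) hxδ
    rw [hx] at h2 h3
    refine Function.minimalPeriod_eq_prime ?_ ?_
    · change T a (T a x) = x
      rw [h2, h3]
    · intro hfix
      have : s x = τ (s x) := by
        rw [← (hγ _ h1).2.1, ← h2, hfix]
      have h5 := h4 hne
      rw [← this] at h5
      nlinarith [mul_self_nonneg (s x)]
  · intro V hV hVV₀
    have hγV : ∀ᶠ t in 𝓝 (0 : ℝ), γ t ∈ V ∧ |t| < δ := by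
      refine (hγc.eventually (by rwa [h0])).and ?_
      exact (continuous_abs.tendsto' (0 : ℝ) 0 abs_zero).eventually (gt_mem_nhds hδ)
    obtain ⟨ε', hε', hball⟩ := Metric.eventually_nhds_iff.1 hγV
    simp only [dist_zero_right, Real.norm_eq_abs] at hball
    -- Halving keeps the closed interval `[-ε, ε]` inside the good range, so `h` can be evaluated at
    -- its endpoints.
    set ε := ε' / 2 with hε
    have hεpos : 0 < ε := half_pos hε'
    have hεb {t : ℝ} (ht : |t| ≤ ε) : γ t ∈ V ∧ |t| < δ :=
      hball (ht.trans_lt (half_lt_self hε'))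
    have hcont : ContinuousOn h (Icc (-ε) ε) := fun t ht =>
      (hh' t ((hεb (abs_le.2 ht)).2.trans_le hδ₁)).1.continuousAt.continuousWithinAt
    have hcont_pos : ContinuousOn h (Icc 0 ε) := hcont.mono (Icc_subset_Icc_left (by linarith))
    have hcont_neg : ContinuousOn h (Icc (-ε) 0) := hcont.mono (Icc_subset_Icc_right hεpos.le)
    have hpos : 0 < h ε := by
      rw [← hh0]
      refine strictMonoOn_of_deriv_pos (convex_Icc 0 ε) hcont_pos (fun x hx => ?_)
        (left_mem_Icc.2 hεpos.le) (right_mem_Icc.2 hεpos.le) hεpos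
      rw [interior_Icc] at hx
      have hxδ : |x| < δ₁ := (hεb (by rw [abs_of_pos hx.1]; exact hx.2.le)).2.trans_le hδ₁
      rw [(hh' x hxδ).1.deriv]
      exact pos_of_mul_pos_right ((hh' x hxδ).2 hx.1.ne') hx.1.le
    have hneg : 0 < h (-ε) := by
      rw [← hh0]
      refine strictAntiOn_of_deriv_neg (convex_Icc (-ε) 0) hcont_neg (fun x hx => ?_)
        (left_mem_Icc.2 (by linarith)) (right_mem_Icc.2 (by linarith)) (by linarith)
      rw [interior_Icc] at hx
      have hxδ : |x| < δ₁ := (hεb (by rw [abs_of_neg hx.2]; linarith [hx.1])).2.trans_le hδ₁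
      rw [(hh' x hxδ).1.deriv]
      exact neg_of_mul_pos_right ((hh' x hxδ).2 hx.2.ne) hx.2.le
    have hm : 0 < min (h ε) (h (-ε)) := lt_min hpos hneg
    -- This bound makes the level `λ² / 4` lie below both endpoint values, so it is attained on each
    -- side within `V`; monotonicity on the larger range `|t| < δ₁` excludes other points of `V`.
    refine ⟨2 * √(min (h ε) (h (-ε))), by positivity, fun lam hlam hlam₀ => ?_⟩
    have hc : 0 < lam ^ 2 / 4 := by positivity
    have hcm : lam ^ 2 / 4 < min (h ε) (h (-ε)) := by
      have := Real.sq_sqrt hm.le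
      nlinarith [Real.sqrt_nonneg (min (h ε) (h (-ε)))]
    have hne {t : ℝ} (ht : h t = lam ^ 2 / 4) : t ≠ 0 := by
      rintro rfl
      rw [hh0] at ht
      exact hc.ne ht
    obtain ⟨u, hu, hhu⟩ := intermediate_value_Ioo hεpos.le hcont_pos
      (by rw [hh0]; exact ⟨hc, hcm.trans_le (min_le_left _ _)⟩)
    obtain ⟨w, hw, hhw⟩ := intermediate_value_Ioo' (neg_nonpos.2 hεpos.le) hcont_neg
      (by rw [hh0]; exact ⟨hc, hcm.trans_le (min_le_right _ _)⟩)
    have huε : |u| ≤ ε := by rw [abs_of_pos hu.1]; exact hu.2.le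
    have hwε : |w| ≤ ε := by rw [abs_of_neg hw.2]; linarith [hw.1]
    have huδ := (hεb huε).2
    have hwδ := (hεb hwε).2
    have key (x : R3) (hx : x ∈ W ∩ S lam ∩ V) :
        γ (s x) = x ∧ |s x| < δ ∧ h (s x) = lam ^ 2 / 4 := by
      obtain ⟨⟨hxW, hxS⟩, hxV⟩ := hx
      have hxV₀ := hVV₀ hxV
      refine ⟨hxV₀.1 hxW, hxV₀.2, ?_⟩
      rw [hh]
      change frickeVogt (γ (s x)) = _
      rw [hxV₀.1 hxW]
      exact hxS
    refine ⟨fun x hx => ?_, γ u, γ w, ?_, ?_, ?_⟩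
    · obtain ⟨h1, h2, h3⟩ := key x hx
      have h2' := h2.trans_le hδ₁
      have hS : S lam = {y | frickeVogt y = frickeVogt x} := by
        rw [S, show frickeVogt x = lam ^ 2 / 4 from hx.1.2]
      rw [hS]
      refine transversalAt_levelSet (hasStrictFDerivAt_frickeVogt x) (v := deriv γ (s x))
        (Submodule.subset_span ⟨fun t => γ (s x + t), by simpa using h1, ?_, ?_⟩) ?_
      · have : ∀ᶠ t in 𝓝 (0 : ℝ), |s x + t| < δ₁ := by
          have hc : Continuous fun t : ℝ => |s x + t| := by fun_prop
          exact (hc.tendsto 0).eventually (gt_mem_nhds (by simpa using h2'))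
        exact this.mono fun t ht => (hγ _ ht).1
      · have hd : HasDerivAt γ (deriv γ (s x)) (s x + 0) := by
          simpa using (hγ _ h2').2.2.1.hasDerivAt
        exact hd.comp_const_add (s x) 0
      · have := (hh' _ h2').2 (hne h3)
        rw [h1] at this
        exact right_ne_zero_of_mul this.ne'
    · intro huw
      have := congrArg s huw
      rw [(hγ u (huδ.trans_le hδ₁)).2.1, (hγ w (hwδ.trans_le hδ₁)).2.1] at this
      linarith [hu.1, hw.2]
    · ext x
      constructor
      · intro hx
        obtain ⟨h1, h2, h3⟩ := key x hx
        rw [mem_insert_iff, mem_singleton_iff, ← h1]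
        rcases lt_or_gt_of_ne (hne h3) with hlt | hgt
        · exact .inr (congrArg γ (hinj (h2.trans_le hδ₁) (hwδ.trans_le hδ₁)
            (mul_pos_of_neg_of_neg hlt hw.2) (h3.trans hhw.symm)))
        · exact .inl (congrArg γ (hinj (h2.trans_le hδ₁) (huδ.trans_le hδ₁)
            (mul_pos hgt hu.1) (h3.trans hhu.symm)))
      · rintro (rfl | rfl)
        · exact ⟨⟨(hγ u (huδ.trans_le hδ₁)).1, hhu⟩, (hεb huε).1⟩
        · exact ⟨⟨(hγ w (hwδ.trans_le hδ₁)).1, hhw⟩, (hεb hwε).1⟩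
    · obtain ⟨hu1, hu2, hu3, hu4⟩ := hτ u huδ
      -- `τ u` is negative and at the same level as `w`, so the two agree.
      have hτu : τ u = w := by
        refine hinj hu1 (hwδ.trans_le hδ₁)
          (mul_pos_of_neg_of_neg (neg_of_mul_neg_right (hu4 hu.1.ne') hu.1.le) hw.2) ?_
        rw [hhw, ← hhu]
        change frickeVogt (γ (τ u)) = frickeVogt (γ u)
        rw [← hu2, frickeVogt_T]
      rw [hτu] at hu2 hu3
      rw [image_pair, hu2, hu3, pair_comm]

end TraceMap


theorem propositionP (a : ℕ) (ha : 1 ≤ a) :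
    (∃ W : Set TraceMap.R3, TraceMap.IsCenterManifold ∞ (TraceMap.T a) TraceMap.P₁ W) ∧
    ∀ W : Set TraceMap.R3, TraceMap.IsCenterManifold 1 (TraceMap.T a) TraceMap.P₁ W →
      TraceMap.IsEmbeddedSubmanifold 1 1 W ∧
      ∃ V₀ ∈ 𝓝 TraceMap.P₁,
        ((∀ x ∈ W ∩ V₀, TraceMap.T a x = x) ∨
          (∀ x ∈ W ∩ V₀, x ≠ TraceMap.P₁ → Function.minimalPeriod (TraceMap.T a) x = 2)) ∧
        ∀ V ∈ 𝓝 TraceMap.P₁, V ⊆ V₀ →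
          ∃ lam₀ : ℝ, 0 < lam₀ ∧ ∀ lam : ℝ, 0 < lam → lam < lam₀ →
            (∀ x ∈ W ∩ TraceMap.S lam ∩ V, TraceMap.TransversalAt W (TraceMap.S lam) x) ∧
            ∃ p q : TraceMap.R3, p ≠ q ∧ W ∩ TraceMap.S lam ∩ V = {p, q} ∧
              TraceMap.T a '' {p, q} = {p, q} := by
  refine ⟨TraceMap.exists_isCenterManifold a ha, fun W hW => ?_⟩
  obtain ⟨hsub, V₀, hV₀, hper, h⟩ := TraceMap.isEmbeddedSubmanifold_and_dynamics a ha W hW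
  exact ⟨hsub, V₀, hV₀, .inr hper, h⟩
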